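/- For a probability measure $\mu$ on $\mathbb R$ with distribution function $F$, let $F^{-1}(p)=\inf\{x : F(x)\ge p\}\in[-\infty,\infty]$. A $K$-armed bandit is a tuple $\nu=(\nu_1,\dots,\nu_K)$ of probability measures on $\mathbb R$ with distribution functions $F_1,\dots,F_K$; an arm $i^*$ is its unique best arm at level $q$ if $F_i^{-1}(q)<F_{i^*}^{-1}(q)$ for all $i\ne i^*$, and then the gap of an arm $i\neq i^*$ is $$\Delta_i=\sup\{\eta\ge 0:\ F_i^{-1}(q+\eta)\le F_{i^*}^{-1}(q-\eta)\}.$$ A (possibly randomized) policy decides in each round, on the basis of the arms pulled and the rewards observed so far, either to pull an arm $i$, whereupon it receives an independent reward of law $\nu_i$, or to stop and declare an arm $\hat k$; $\tau\in\{0,1,\dots\}\cup\{\infty\}$ is the number of pulls before it stops. The policy is $\delta$-PAC (at level $q$) if, on every $K$-armed bandit with a unique best arm $i^*$ and gaps $\Delta_i>0$ for all $i\ne i^*$, it stops and declares $\hat k=i^*$ with probability at least $1-\delta$. **Theorem.** Let $K\ge 1$, $q\in(1/3,1)$ and $\delta\in(0,1)$. There exists a $K$-armed bandit $\nu$ with a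 unique best arm $i^*$ at level $q$ and gaps $\Delta_i\in(0,1/4)$ for all $i\neq i^*$, each of whose arms is a mixture $w_i\,\delta_0+(1-w_i)\,\mathrm{Unif}[0,1]$, $w_i\in(0,1)$, of a point mass at $0$ and the uniform distribution on $[0,1]$, such that every $\delta$-PAC policy $\pi$ satisfies, when run on $\nu$, $$\mathbb E_{\pi}[\tau]\ \ge\ \sum_{j\ne i^*}\frac{3(1-q)^2}{100\,\Delta_j^2}\,\log\frac{1}{4\delta}.$$ -/

import Mathlib

open MeasureTheory ProbabilityTheory
open scoped ENNReal

noncomputable section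

namespace QuantileBandit

/-! ### Quantiles, best arm, suboptimality gap -/

/-- The (left) `p`-quantile `inf {x : F(x) ≥ p}` of a distribution on the real line with
distribution function `F`. It is extended-real-valued, so that the infimum is `+∞` when no `x`
qualifies (for instance for `p > 1`) and `-∞` when every `x` does (for `p ≤ 0`). -/
def quantile (μ : Measure ℝ) (p : ℝ) : EReal :=
  sInf ((fun x : ℝ => (x : EReal)) '' {x : ℝ | p ≤ cdf μ x})

/-- The suboptimality gap at level `q` between a distribution `μl` (suboptimal arm) and a
distribution `μh` (best arm): the supremum of the `η ≥ 0` such that the `(q+η)`-quantile of `μl`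
is at most the `(q-η)`-quantile of `μh`. For `q > 0` and probability measures the set is
contained in `[0, q]`, so this is a supremum of a bounded set. -/
def gap (q : ℝ) (μl μh : Measure ℝ) : ℝ :=
  sSup {η : ℝ | 0 ≤ η ∧ quantile μl (q + η) ≤ quantile μh (q - η)}

/-- Arm `i` is the unique best arm: its `q`-quantile is strictly larger than all the others. -/
def IsBestArm {K : ℕ} (q : ℝ) (ν : Fin K → ProbabilityMeasure ℝ) (i : Fin K) : Prop :=
  ∀ j, j ≠ i → quantile (ν j) q < quantile (ν i) q

/-- The mixture of a point mass at `0` (weight `w`) and the uniform distribution on `[0,1]`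
(weight `1 - w`). -/
def zeroUniformMixture (w : ℝ) : Measure ℝ :=
  ENNReal.ofReal w • Measure.dirac 0 +
    ENNReal.ofReal (1 - w) • (volume : Measure ℝ).restrict (Set.Icc 0 1)

/-! ### Policies and their interaction with a bandit -/

/-- What a policy decides in one round: `inl i` means "pull arm `i`", and `inr k` means
"stop sampling and declare arm `k`". -/
abbrev Decision (K : ℕ) : Type := Fin K ⊕ Fin K

/-- What is recorded in one round: `inl (i, x)` means "arm `i` was pulled and the reward was `x`",
and `inr k` means "the policy has stopped and has declared arm `k`". -/
abbrev Outcome (K : ℕ) : Type := (Fin K × ℝ) ⊕ Fin K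

/-- A (possibly randomized) policy for `K` arms: the distribution of the decision in round `0`, and
the conditional distribution of the decision in round `n + 1` given the outcomes of the
rounds `0, …, n`. (What it prescribes after it has stopped is never used.) -/
structure Policy (K : ℕ) where
  first : Measure (Decision K)
  next : (n : ℕ) → Kernel (Finset.Iic n → Outcome K) (Decision K)
  first_prob : IsProbabilityMeasure first
  next_markov : ∀ n, IsMarkovKernel (next n)

attribute [instance] Policy.first_prob Policy.next_markov

variable {K : ℕ}

/-- The bandit's answer to a decision: a reward drawn from the law of the pulled arm. -/
def answer (ν : Fin K → ProbabilityMeasure ℝ) : Kernel (Decision K) (Outcome K) where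
  toFun := Sum.elim (fun i => (ν i : Measure ℝ).map fun x => .inl (i, x))
    (fun k => Measure.dirac (.inr k))
  measurable' := Measurable.sumElim (measurable_of_countable _) (measurable_of_countable _)

instance (ν : Fin K → ProbabilityMeasure ℝ) : IsMarkovKernel (answer ν) := by
  refine ⟨fun d => ?_⟩
  rcases d with i | k
  · exact Measure.isProbabilityMeasure_map
      (measurable_inl.comp measurable_prodMk_left).aemeasurable
  · exact inferInstanceAs (IsProbabilityMeasure (Measure.dirac (Sum.inr k : Outcome K)))

/-- The histories of the rounds `0, …, n` in which the policy has stopped by round `n`. -/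
def stoppedBy (K n : ℕ) : Set (Finset.Iic n → Outcome K) :=
  {h | (h ⟨n, Finset.mem_Iic.2 le_rfl⟩).isRight}

lemma measurableSet_isRight (K : ℕ) : MeasurableSet {o : Outcome K | o.isRight} := by
  have : {o : Outcome K | o.isRight} = Set.range Sum.inr := by
    ext o; cases o <;> simp
  rw [this]
  exact measurableSet_range_inr

lemma measurableSet_stoppedBy (K n : ℕ) : MeasurableSet (stoppedBy K n) :=
  measurable_pi_apply (X := fun _ : Finset.Iic n => Outcome K) ⟨n, Finset.mem_Iic.2 le_rfl⟩
    (measurableSet_isRight K)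

open Classical in
/-- The conditional law of the outcome of round `n + 1` given the outcomes of the rounds
`0, …, n`: once the policy has stopped, its declaration is repeated forever; otherwise the policy
takes a decision and the bandit answers. -/
def Policy.round (π : Policy K) (ν : Fin K → ProbabilityMeasure ℝ) (n : ℕ) :
    Kernel (Finset.Iic n → Outcome K) (Outcome K) :=
  Kernel.piecewise (measurableSet_stoppedBy K n)
    (Kernel.deterministic (fun h => h ⟨n, Finset.mem_Iic.2 le_rfl⟩) (measurable_pi_apply _))
    (answer ν ∘ₖ π.next n)

instance (π : Policy K) (ν : Fin K → ProbabilityMeasure ℝ) (n : ℕ) :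
    IsMarkovKernel (π.round ν n) := by
  unfold Policy.round
  infer_instance

/-- The law, on infinite sequences of outcomes, of the interaction of a policy with a bandit. -/
def Policy.law (π : Policy K) (ν : Fin K → ProbabilityMeasure ℝ) : Measure (ℕ → Outcome K) :=
  Kernel.trajMeasure (X := fun _ => Outcome K) (answer ν ∘ₘ π.first) (π.round ν)

/-- The stopping time: the number of pulls made before the policy stops, `∞` if it never does. -/
def stoppingTime (ω : ℕ → Outcome K) : ℝ≥0∞ :=
  ⨅ (n : ℕ) (_ : (ω n).isRight), (n : ℝ≥0∞)

/-- The event that the policy stops, and declares arm `k`. -/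
def declares (k : Fin K) : Set (ℕ → Outcome K) :=
  {ω | ∃ n, ω n = .inr k ∧ ∀ m < n, (ω m).isLeft}

/-- `δ`-PAC policies for the level `q`: on every bandit with a unique best arm and positive
gaps, the policy stops and declares the best arm with probability at least `1 - δ`. -/
def Policy.IsPAC (q δ : ℝ) (π : Policy K) : Prop :=
  ∀ (ν : Fin K → ProbabilityMeasure ℝ) (i : Fin K),
    IsBestArm q ν i → (∀ j, j ≠ i → 0 < gap q (ν j) (ν i)) →
      ENNReal.ofReal (1 - δ) ≤ π.law ν (declares i)

end QuantileBandit

end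

noncomputable section

namespace QuantileBandit

variable {K : ℕ}

/-! ### Quantiles and gaps of the mixtures -/

/-! One instance serves for all levels `q > 1/3`: the best arm `k` has weight `1/6` at `0`, the
others `7/12`. The quantiles are explicit, so each gap is at least `(1 - q) / 3` (`le_gap_hard`) and
below `1/4` (`gap_hard_lt`). Hence `3 (1 - q)² / (100 Δ²) ≤ 27/100`, and it is enough that every
suboptimal arm be pulled `(27/100) log (1/(4δ))` times on average.

Lowering the weight of arm `j` to `7/48` makes `j` the best arm, so a `δ`-PAC policy declares `k`
with probability at most `δ` on the changed bandit. The law of arm `j` is at most `4` times its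
changed law, so on the event that at most `m` pulls of `j` precede the stop, probabilities grow by
at most `4^m` on returning to the original bandit (`lintegral_law_le`, `law_declares_le`). Therefore
`1 - δ ≤ P(N_j ≥ m + 1) + 4^m δ`, where `N_j` counts the pulls of `j`. Taking `4^m ≤ 1/(4δ) <
4^(m+1)` gives `P(N_j ≥ m + 1) ≥ 1/2`, and Markov's inequality bounds the mean of `N_j`
(`le_lintegral_pullCount`). This bounded likelihood ratio replaces any use of relative entropy.
Finally, the `N_j` sum to at most `τ`. -/

lemma isProbabilityMeasure_zeroUniformMixture {w : ℝ} (h0 : 0 ≤ w) (h1 : w ≤ 1) :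
    IsProbabilityMeasure (zeroUniformMixture w) := by
  refine ⟨?_⟩
  simp only [zeroUniformMixture, Measure.add_apply, Measure.smul_apply, measure_univ, smul_eq_mul,
    mul_one, Measure.restrict_apply_univ, Real.volume_Icc, sub_zero, ENNReal.ofReal_one]
  rw [← ENNReal.ofReal_add h0 (by linarith)]
  simp

lemma zeroUniformMixture_Iic_of_neg (w : ℝ) {x : ℝ} (hx : x < 0) :
    zeroUniformMixture w (Set.Iic x) = 0 := by
  have h : Set.Iic x ∩ Set.Icc 0 1 = ∅ := by
    ext y
    simp only [Set.mem_inter_iff, Set.mem_Iic, Set.mem_Icc, Set.mem_empty_iff_false, iff_false]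
    rintro ⟨h1, h2, -⟩
    linarith
  simp [zeroUniformMixture, Measure.restrict_apply measurableSet_Iic, h, hx]

lemma zeroUniformMixture_Iic_of_nonneg {w : ℝ} (h0 : 0 ≤ w) (h1 : w ≤ 1) {x : ℝ} (hx : 0 ≤ x) :
    zeroUniformMixture w (Set.Iic x) = ENNReal.ofReal (w + (1 - w) * min x 1) := by
  have h : Set.Iic x ∩ Set.Icc 0 1 = Set.Icc 0 (min x 1) := by
    ext y
    simp only [Set.mem_inter_iff, Set.mem_Iic, Set.mem_Icc, le_min_iff]
    tauto
  have hm : 0 ≤ min x 1 := le_min hx zero_le_one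
  rw [ENNReal.ofReal_add h0 (mul_nonneg (by linarith) hm),
    ENNReal.ofReal_mul (by linarith : (0 : ℝ) ≤ 1 - w)]
  simp [zeroUniformMixture, Measure.restrict_apply measurableSet_Iic, h, hx]

lemma le_cdf_zeroUniformMixture_iff {w p : ℝ} (h0 : 0 ≤ w) (h1 : w < 1) (hp : 0 < p)
    (hp1 : p ≤ 1) (x : ℝ) :
    p ≤ cdf (zeroUniformMixture w) x ↔ max 0 ((p - w) / (1 - w)) ≤ x := by
  have := isProbabilityMeasure_zeroUniformMixture h0 h1.le
  have hw : 0 < 1 - w := by linarith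
  rw [cdf_eq_real, measureReal_def, max_le_iff]
  rcases lt_or_ge x 0 with hx | hx
  · rw [zeroUniformMixture_Iic_of_neg w hx]
    exact iff_of_false hp.not_ge fun h => hx.not_ge h.1
  · rw [zeroUniformMixture_Iic_of_nonneg h0 h1.le hx, ENNReal.toReal_ofReal
      (add_nonneg h0 (mul_nonneg hw.le (le_min hx zero_le_one))), div_le_iff₀ hw]
    rcases le_total x 1 with h | h
    · rw [min_eq_left h]
      constructor
      · intro h'
        exact ⟨hx, by linarith⟩
      · rintro ⟨-, h'⟩
        linarith
    · rw [min_eq_right h]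
      constructor
      · intro _
        exact ⟨hx, by nlinarith⟩
      · intro _
        linarith

lemma quantile_zeroUniformMixture {w p : ℝ} (h0 : 0 ≤ w) (h1 : w < 1) (hp : 0 < p) (hp1 : p ≤ 1) :
    quantile (zeroUniformMixture w) p = ((max 0 ((p - w) / (1 - w)) : ℝ) : EReal) := by
  have h : {x : ℝ | p ≤ cdf (zeroUniformMixture w) x} = Set.Ici (max 0 ((p - w) / (1 - w))) := by
    ext x
    exact le_cdf_zeroUniformMixture_iff h0 h1 hp hp1 x
  rw [quantile, h]
  refine IsLeast.csInf_eq ⟨Set.mem_image_of_mem _ Set.self_mem_Ici, ?_⟩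
  rintro _ ⟨x, hx, rfl⟩
  exact EReal.coe_le_coe_iff.2 hx

lemma quantile_of_nonpos (μ : Measure ℝ) {p : ℝ} (hp : p ≤ 0) : quantile μ p = ⊥ := by
  rw [quantile, sInf_eq_bot]
  intro b hb
  obtain ⟨x, -, hx⟩ := EReal.lt_iff_exists_real_btwn.1 hb
  exact ⟨x, ⟨x, hp.trans (cdf_nonneg μ x), rfl⟩, hx⟩

lemma quantile_of_one_lt (μ : Measure ℝ) {p : ℝ} (hp : 1 < p) : quantile μ p = ⊤ := by
  have h : {x : ℝ | p ≤ cdf μ x} = ∅ := by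
    ext x
    simpa using (cdf_le_one μ x).trans_lt hp
  simp [quantile, h]

lemma quantile_zeroUniformMixture_ne_bot {w p : ℝ} (h0 : 0 ≤ w) (h1 : w < 1) (hp : 0 < p) :
    quantile (zeroUniformMixture w) p ≠ ⊥ := by
  rcases le_or_gt p 1 with hp1 | hp1
  · rw [quantile_zeroUniformMixture h0 h1 hp hp1]
    exact EReal.coe_ne_bot _
  · rw [quantile_of_one_lt _ hp1]
    exact top_ne_bot

/-- The set whose supremum is the gap, for two mixtures, in closed form. -/
lemma mem_gap_set_iff {q w v η : ℝ} (hq : 0 < q) (hq1 : q < 1) (hw0 : 0 ≤ w) (hw1 : w < 1)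
    (hv0 : 0 ≤ v) (hv1 : v < 1) :
    (0 ≤ η ∧ quantile (zeroUniformMixture w) (q + η) ≤ quantile (zeroUniformMixture v) (q - η)) ↔
      0 ≤ η ∧ η < q ∧ η ≤ 1 - q ∧
        (q + η ≤ w ∨ (1 - q + η) * (1 - w) ≤ (1 - q - η) * (1 - v)) := by
  refine and_congr_right fun hη => ?_
  rcases le_or_gt q η with h | h
  · rw [quantile_of_nonpos (zeroUniformMixture v) (by linarith), le_bot_iff]
    exact iff_of_false (quantile_zeroUniformMixture_ne_bot hw0 hw1 (by linarith))
      fun h' => h'.1.not_ge h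
  rw [quantile_zeroUniformMixture hv0 hv1 (by linarith : 0 < q - η) (by linarith)]
  rcases lt_or_ge (1 - q) η with h' | h'
  · rw [quantile_of_one_lt _ (by linarith : 1 < q + η), top_le_iff]
    exact iff_of_false (EReal.coe_ne_top _) fun h'' => h''.2.1.not_gt h'
  rw [quantile_zeroUniformMixture hw0 hw1 (by linarith : 0 < q + η) (by linarith),
    EReal.coe_le_coe_iff]
  have hw : 0 < 1 - w := by linarith
  have hv : 0 < 1 - v := by linarith
  have key : (q + η - w) / (1 - w) ≤ (q - η - v) / (1 - v) ↔
      (1 - q + η) * (1 - w) ≤ (1 - q - η) * (1 - v) := by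
    rw [div_le_div_iff₀ hw hv]
    constructor <;> intro h <;> nlinarith
  rw [max_le_iff, le_max_iff, le_max_iff, key, div_nonpos_iff]
  constructor
  · rintro ⟨-, (⟨-, h2⟩ | ⟨h2, -⟩) | h1⟩
    · linarith
    · exact ⟨h, h', .inl (by linarith)⟩
    · exact ⟨h, h', .inr h1⟩
  · rintro ⟨-, -, h1 | h1⟩
    · exact ⟨.inl le_rfl, .inl (.inr ⟨by linarith, hw.le⟩)⟩
    · exact ⟨.inl le_rfl, .inr h1⟩

lemma le_gap_zeroUniformMixture {q w v η : ℝ} (hq : 0 < q) (hq1 : q < 1) (hw0 : 0 ≤ w)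
    (hw1 : w < 1) (hv0 : 0 ≤ v) (hv1 : v < 1) (h0 : 0 ≤ η) (h1 : η < q) (h2 : η ≤ 1 - q)
    (h : (1 - q + η) * (1 - w) ≤ (1 - q - η) * (1 - v)) :
    η ≤ gap q (zeroUniformMixture w) (zeroUniformMixture v) :=
  le_csSup ⟨q, fun _ h' => ((mem_gap_set_iff hq hq1 hw0 hw1 hv0 hv1).1 h').2.1.le⟩
    ((mem_gap_set_iff hq hq1 hw0 hw1 hv0 hv1).2 ⟨h0, h1, h2, .inr h⟩)

lemma gap_zeroUniformMixture_pos {q w v : ℝ} (hq : 0 < q) (hq1 : q < 1) (hv0 : 0 ≤ v)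
    (hvw : v < w) (hw1 : w < 1) :
    0 < gap q (zeroUniformMixture w) (zeroUniformMixture v) := by
  -- The condition on `η` reads `η * ((1 - w) + (1 - v)) ≤ (1 - q) * (w - v)`, and the factor of `η`
  -- is at most `2`.
  have hpos : 0 < min (q / 2) ((1 - q) * (w - v) / 2) :=
    lt_min (by linarith) (div_pos (mul_pos (by linarith) (by linarith)) two_pos)
  have hl := min_le_left (q / 2) ((1 - q) * (w - v) / 2)
  have hr := min_le_right (q / 2) ((1 - q) * (w - v) / 2)
  refine hpos.trans_le (le_gap_zeroUniformMixture hq hq1 (hv0.trans hvw.le) hw1 hv0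
    (hvw.trans hw1) hpos.le (by linarith) ?_ ?_)
  · nlinarith
  · nlinarith

/-- For `q < 1` the map `w ↦ (q - w) / (1 - w)` is strictly decreasing; `v < q` keeps the larger
quantile positive, so that truncation at `0` cannot produce a tie. -/
lemma quantile_zeroUniformMixture_lt {q w v : ℝ} (hq1 : q < 1) (hv0 : 0 ≤ v)
    (hvw : v < w) (hvq : v < q) (hw1 : w < 1) :
    quantile (zeroUniformMixture w) q < quantile (zeroUniformMixture v) q := by
  have hq : 0 < q := by linarith
  rw [quantile_zeroUniformMixture (by linarith) hw1 hq hq1.le,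
    quantile_zeroUniformMixture hv0 (by linarith) hq hq1.le, EReal.coe_lt_coe_iff]
  have hpos : 0 < (q - v) / (1 - v) := div_pos (by linarith) (by linarith)
  refine lt_max_of_lt_right (max_lt hpos ?_)
  rw [div_lt_div_iff₀ (by linarith) (by linarith)]
  nlinarith

lemma zeroUniformMixture_le_smul {w v c : ℝ} (hc : 0 ≤ c) (h : w ≤ c * v)
    (h' : 1 - w ≤ c * (1 - v)) :
    zeroUniformMixture w ≤ ENNReal.ofReal c • zeroUniformMixture v := by
  rw [zeroUniformMixture, zeroUniformMixture, smul_add, smul_smul, smul_smul,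
    ← ENNReal.ofReal_mul hc, ← ENNReal.ofReal_mul hc]
  refine add_le_add ?_ ?_ <;> refine Measure.le_iff'.2 fun s => ?_ <;>
    simp only [Measure.smul_apply, smul_eq_mul] <;> gcongr

/-- The mixture with weight `w ∈ (0, 1)` as a probability measure. -/
def mixtureArm (w : Set.Ioo (0 : ℝ) 1) : ProbabilityMeasure ℝ :=
  ⟨zeroUniformMixture w, isProbabilityMeasure_zeroUniformMixture w.2.1.le w.2.2.le⟩

lemma coe_mixtureArm (w : Set.Ioo (0 : ℝ) 1) :
    (mixtureArm w : Measure ℝ) = zeroUniformMixture w := rfl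

/-- The arm with the strictly smallest weight at `0`, if this weight is below the level, is the
best one. -/
lemma isBestArm_mixtureArm {q : ℝ} (hq1 : q < 1) {w : Fin K → Set.Ioo (0 : ℝ) 1} {i : Fin K}
    (hi : (w i : ℝ) < q) (h : ∀ j, j ≠ i → w i < w j) :
    IsBestArm q (fun j => mixtureArm (w j)) i := fun j hj =>
  quantile_zeroUniformMixture_lt hq1 (w i).2.1.le (h j hj) hi (w j).2.2

/-! ### Comparison of the laws of two bandits -/

instance (π : Policy K) (ν : Fin K → ProbabilityMeasure ℝ) : IsProbabilityMeasure (π.law ν) := by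
  unfold Policy.law
  infer_instance

/-- The weight of an outcome: `c i` for a pull of arm `i`, and `1` for a declaration. -/
def weight (c : Fin K → ℝ≥0∞) : Outcome K → ℝ≥0∞ :=
  Sum.elim (fun p => c p.1) fun _ => 1

lemma measurable_weight (c : Fin K → ℝ≥0∞) : Measurable (weight c) :=
  ((measurable_of_countable c).comp measurable_fst).sumElim measurable_const

section Comparison

variable {ν ν' : Fin K → ProbabilityMeasure ℝ} {c : Fin K → ℝ≥0∞}

lemma lintegral_answer_le (h : ∀ i, (ν i : Measure ℝ) ≤ c i • (ν' i : Measure ℝ))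
    {f : Outcome K → ℝ≥0∞} (hf : Measurable f) (d : Decision K) :
    ∫⁻ o, f o ∂answer ν d ≤ ∫⁻ o, f o * weight c o ∂answer ν' d := by
  have hfw : Measurable fun o => f o * weight c o := hf.mul (measurable_weight c)
  rcases d with i | k
  · have hm : Measurable fun x : ℝ => (Sum.inl (i, x) : Outcome K) :=
      measurable_inl.comp measurable_prodMk_left
    change ∫⁻ o, f o ∂((ν i : Measure ℝ).map fun x => .inl (i, x)) ≤
      ∫⁻ o, f o * weight c o ∂((ν' i : Measure ℝ).map fun x => .inl (i, x))
    rw [lintegral_map hf hm, lintegral_map hfw hm]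
    calc ∫⁻ x, f (.inl (i, x)) ∂(ν i : Measure ℝ)
        ≤ ∫⁻ x, f (.inl (i, x)) ∂(c i • (ν' i : Measure ℝ)) := lintegral_mono' (h i) le_rfl
      _ = ∫⁻ x, f (.inl (i, x)) * weight c (.inl (i, x)) ∂(ν' i : Measure ℝ) := by
        rw [lintegral_smul_measure, smul_eq_mul, mul_comm]
        exact (lintegral_mul_const _ (hf.comp hm)).symm
  · change ∫⁻ o, f o ∂(Measure.dirac (Sum.inr k)) ≤
      ∫⁻ o, f o * weight c o ∂(Measure.dirac (Sum.inr k))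
    rw [lintegral_dirac' _ hf, lintegral_dirac' _ hfw]
    simp [weight]

/-- The policy's decisions have the same law on both bandits, and a declaration, first or repeated,
has weight `1`. Only pulls cost a factor. -/
lemma lintegral_round_le (π : Policy K) (h : ∀ i, (ν i : Measure ℝ) ≤ c i • (ν' i : Measure ℝ))
    {f : Outcome K → ℝ≥0∞} (hf : Measurable f) (n : ℕ) (x : Finset.Iic n → Outcome K) :
    ∫⁻ o, f o ∂π.round ν n x ≤ ∫⁻ o, f o * weight c o ∂π.round ν' n x := by
  have hfw : Measurable fun o => f o * weight c o := hf.mul (measurable_weight c)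
  simp only [Policy.round, Kernel.piecewise_apply]
  split_ifs with hx
  · rw [Kernel.deterministic_apply, lintegral_dirac' _ hf, lintegral_dirac' _ hfw]
    obtain ⟨k, hk⟩ := Sum.isRight_iff.1 hx
    simp [hk, weight]
  · rw [Kernel.lintegral_comp _ _ _ hf, Kernel.lintegral_comp _ _ _ hfw]
    exact lintegral_mono fun d => lintegral_answer_le h hf d

lemma lintegral_law_zero (π : Policy K) (ν : Fin K → ProbabilityMeasure ℝ)
    {f : Outcome K → ℝ≥0∞} (hf : Measurable f) :
    ∫⁻ ω, f (ω 0) ∂π.law ν = ∫⁻ d, ∫⁻ o, f o ∂answer ν d ∂π.first := by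
  have hm : (π.law ν).map (Preorder.frestrictLe 0) = (answer ν ∘ₘ π.first).map
      (MeasurableEquiv.piUnique (fun i : Finset.Iic 0 => Outcome K)).symm := by
    rw [Policy.law, Kernel.trajMeasure, Measure.map_comp _ _ (by fun_prop),
      Kernel.traj_map_frestrictLe, Kernel.partialTraj_self, Measure.id_comp]
  have hg : Measurable fun h : Finset.Iic 0 → Outcome K => f (h ⟨0, Finset.mem_Iic.2 le_rfl⟩) :=
    hf.comp (measurable_pi_apply _)
  calc ∫⁻ ω, f (ω 0) ∂π.law ν
      = ∫⁻ h, f (h ⟨0, Finset.mem_Iic.2 le_rfl⟩) ∂((π.law ν).map (Preorder.frestrictLe 0)) := by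
        rw [lintegral_map hg (by fun_prop)]
        rfl
    _ = ∫⁻ o, f o ∂(answer ν ∘ₘ π.first) := by
        rw [hm, lintegral_map hg (MeasurableEquiv.measurable _)]
        rfl
    _ = _ := Measure.lintegral_bind (Kernel.aemeasurable _) hf.aemeasurable

lemma lintegral_law_succ (π : Policy K) (ν : Fin K → ProbabilityMeasure ℝ) (n : ℕ)
    {f : (Finset.Iic n → Outcome K) × Outcome K → ℝ≥0∞} (hf : Measurable f) :
    ∫⁻ ω, f (Preorder.frestrictLe n ω, ω (n + 1)) ∂π.law ν =
      ∫⁻ ω, ∫⁻ o, f (Preorder.frestrictLe n ω, o) ∂π.round ν n (Preorder.frestrictLe n ω)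
        ∂π.law ν := by
  have hm : (π.law ν).map (Preorder.frestrictLe n) ⊗ₘ π.round ν n =
      (π.law ν).map fun ω => (Preorder.frestrictLe n ω, ω (n + 1)) :=
    Kernel.map_frestrictLe_trajMeasure_compProd_eq_map_trajMeasure
  rw [← lintegral_map (μ := π.law ν) hf (by fun_prop), ← hm, Measure.lintegral_compProd hf,
    lintegral_map hf.lintegral_kernel_prod_right' (by fun_prop)]

/-- The infinite sequence that continues a finite history by repeating one outcome. -/
def extend (n : ℕ) (p : (Finset.Iic n → Outcome K) × Outcome K) (i : ℕ) : Outcome K :=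
  if h : i ≤ n then p.1 ⟨i, Finset.mem_Iic.2 h⟩ else p.2

lemma measurable_extend (n : ℕ) : Measurable (extend (K := K) n) := by
  refine measurable_pi_lambda _ fun i => ?_
  unfold extend
  split_ifs with h
  · exact (measurable_pi_apply _).comp measurable_fst
  · exact measurable_snd

/-- Change of measure: if every arm of `ν` is dominated by `c i` times that of `ν'`, then on the
events of the rounds `0, …, n` the law of the interaction with `ν` is dominated by the product of
the weights of these rounds times the law of the interaction with `ν'`. -/
lemma lintegral_law_le (π : Policy K) (h : ∀ i, (ν i : Measure ℝ) ≤ c i • (ν' i : Measure ℝ))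
    (n : ℕ) {f : (ℕ → Outcome K) → ℝ≥0∞} (hf : Measurable f)
    (hd : ∀ ω ω', (∀ i ≤ n, ω i = ω' i) → f ω = f ω') :
    ∫⁻ ω, f ω ∂π.law ν ≤ ∫⁻ ω, f ω * ∏ i ∈ Finset.range (n + 1), weight c (ω i) ∂π.law ν' := by
  induction n generalizing f with
  | zero =>
    have hg : Measurable fun o : Outcome K => f fun _ => o :=
      hf.comp (measurable_pi_lambda _ fun _ => measurable_id)
    have he : ∀ ω, f ω = f fun _ => ω 0 := fun ω => hd _ _ (by simp)
    calc ∫⁻ ω, f ω ∂π.law ν = ∫⁻ ω, f (fun _ => ω 0) ∂π.law ν := lintegral_congr he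
      _ = ∫⁻ d, ∫⁻ o, f (fun _ => o) ∂answer ν d ∂π.first := lintegral_law_zero π ν hg
      _ ≤ ∫⁻ d, ∫⁻ o, f (fun _ => o) * weight c o ∂answer ν' d ∂π.first :=
        lintegral_mono fun d => lintegral_answer_le h hg d
      _ = ∫⁻ ω, f (fun _ => ω 0) * weight c (ω 0) ∂π.law ν' :=
        (lintegral_law_zero π ν' (hg.mul (measurable_weight c))).symm
      _ = _ := lintegral_congr fun ω => by simp [← he ω]
  | succ n ih =>
    have hg : Measurable fun p => f (extend n p) := hf.comp (measurable_extend n)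
    have hgw : Measurable fun p => f (extend n p) * weight c p.2 :=
      hg.mul ((measurable_weight c).comp measurable_snd)
    -- Since `f` sees only the rounds up to `n + 1`, it is a function of the history up to `n` and
    -- the next outcome, to which the transition kernel applies.
    have he : ∀ ω, f ω = f (extend n (Preorder.frestrictLe n ω, ω (n + 1))) := fun ω =>
      hd _ _ fun i hi => by
        by_cases hin : i ≤ n
        · simp [extend, hin]
        · obtain rfl : i = n + 1 := by omega
          simp [extend]
    -- The last round is transferred to `ν'` first, while the history still follows `ν`. What
    -- remains, `F`, depends on the rounds up to `n` only, so the induction hypothesis transfers the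
    -- history.
    let F : (Finset.Iic n → Outcome K) → ℝ≥0∞ := fun x =>
      ∫⁻ o, f (extend n (x, o)) * weight c o ∂π.round ν' n x
    have hF : Measurable F := hgw.lintegral_kernel_prod_right'
    let W : (Finset.Iic n → Outcome K) → ℝ≥0∞ := fun x =>
      ∏ i ∈ (Finset.range (n + 1)).attach,
        weight c (x ⟨i, Finset.mem_Iic.2 (Nat.lt_succ_iff.1 (Finset.mem_range.1 i.2))⟩)
    have hW : Measurable W := Finset.measurable_prod _ fun i _ =>
      (measurable_weight c).comp (measurable_pi_apply _)
    have hWe : ∀ ω, W (Preorder.frestrictLe n ω) =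
        ∏ i ∈ Finset.range (n + 1), weight c (ω i) := fun ω =>
      Finset.prod_attach (Finset.range (n + 1)) fun i => weight c (ω i)
    calc ∫⁻ ω, f ω ∂π.law ν
        = ∫⁻ ω, f (extend n (Preorder.frestrictLe n ω, ω (n + 1))) ∂π.law ν :=
          lintegral_congr he
      _ = ∫⁻ ω, ∫⁻ o, f (extend n (Preorder.frestrictLe n ω, o))
            ∂π.round ν n (Preorder.frestrictLe n ω) ∂π.law ν := lintegral_law_succ π ν n hg
      _ ≤ ∫⁻ ω, F (Preorder.frestrictLe n ω) ∂π.law ν :=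
          lintegral_mono fun ω => lintegral_round_le π h (hg.comp measurable_prodMk_left) n _
      _ ≤ ∫⁻ ω, F (Preorder.frestrictLe n ω) *
            ∏ i ∈ Finset.range (n + 1), weight c (ω i) ∂π.law ν' := by
          refine ih (hF.comp (by fun_prop)) fun ω ω' hω => congrArg F ?_
          ext i : 1
          exact hω i (Finset.mem_Iic.1 i.2)
      _ = ∫⁻ ω, ∫⁻ o, f (extend n (Preorder.frestrictLe n ω, o)) * weight c o *
            W (Preorder.frestrictLe n ω) ∂π.round ν' n (Preorder.frestrictLe n ω)
            ∂π.law ν' := by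
          refine lintegral_congr fun ω => ?_
          rw [← hWe]
          exact (lintegral_mul_const _ (hgw.comp measurable_prodMk_left)).symm
      _ = ∫⁻ ω, f (extend n (Preorder.frestrictLe n ω, ω (n + 1))) * weight c (ω (n + 1)) *
            W (Preorder.frestrictLe n ω) ∂π.law ν' :=
          (lintegral_law_succ π ν' n (hgw.mul (hW.comp measurable_fst))).symm
      _ = _ := by
          refine lintegral_congr fun ω => ?_
          rw [← he, hWe, Finset.prod_range_succ _ (n + 1), mul_assoc, mul_comm (weight c _)]

end Comparison

/-! ### Stopping and counting pulls -/

/-- The event that the policy stops after `n` rounds, and declares arm `k`. -/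
def stopsAt (k : Fin K) (n : ℕ) : Set (ℕ → Outcome K) :=
  {ω | ω n = .inr k ∧ ∀ m < n, (ω m).isLeft}

lemma declares_eq_iUnion (k : Fin K) : declares k = ⋃ n, stopsAt k n := by
  ext ω
  simp [declares, stopsAt]

lemma measurableSet_isLeft (K : ℕ) : MeasurableSet {o : Outcome K | o.isLeft} := by
  convert (measurableSet_isRight K).compl using 1
  ext o
  cases o <;> simp

lemma measurableSet_stopsAt (k : Fin K) (n : ℕ) : MeasurableSet (stopsAt k n) := by
  have h1 : MeasurableSet {o : Outcome K | o = .inr k} := by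
    have : {o : Outcome K | o = .inr k} = Sum.inr '' {k} := by
      ext o
      simp
    rw [this]
    exact measurableSet_inr_image.2 (measurableSet_singleton k)
  have h2 : stopsAt k n = (fun ω : ℕ → Outcome K => ω n) ⁻¹' {o | o = .inr k} ∩
      ⋂ m, ⋂ (_ : m < n), (fun ω : ℕ → Outcome K => ω m) ⁻¹' {o | o.isLeft} := by
    ext ω
    simp [stopsAt]
  rw [h2]
  exact (measurable_pi_apply n h1).inter <| .iInter fun m => .iInter fun _ =>
    measurable_pi_apply m (measurableSet_isLeft K)

lemma measurableSet_declares (k : Fin K) : MeasurableSet (declares k) := by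
  rw [declares_eq_iUnion]
  exact .iUnion (measurableSet_stopsAt k)

lemma eq_of_mem_stopsAt {k l : Fin K} {m n : ℕ} {ω : ℕ → Outcome K} (hm : ω ∈ stopsAt k m)
    (hn : ω ∈ stopsAt l n) : m = n ∧ k = l := by
  obtain rfl : m = n := by
    rcases lt_trichotomy m n with h | h | h
    · simpa [hm.1] using hn.2 m h
    · exact h
    · simpa [hn.1] using hm.2 n h
  exact ⟨rfl, Sum.inr_injective (hm.1.symm.trans hn.1)⟩

lemma disjoint_declares {k l : Fin K} (h : k ≠ l) : Disjoint (declares k) (declares l) := by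
  rw [Set.disjoint_left]
  rintro ω ⟨m, hm⟩ ⟨n, hn⟩
  exact h (eq_of_mem_stopsAt hm hn).2

/-- The change of measure concerns events of finitely many rounds; this splits a declaration into
such events. -/
lemma measure_declares (μ : Measure (ℕ → Outcome K)) (k : Fin K) :
    μ (declares k) = ∑' n, μ (stopsAt k n) := by
  rw [declares_eq_iUnion]
  refine measure_iUnion (fun m n hmn => ?_) (measurableSet_stopsAt k)
  rw [Function.onFun, Set.disjoint_left]
  exact fun ω hm hn => hmn (eq_of_mem_stopsAt hm hn).1

/-- The outcomes in which arm `j` was pulled. -/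
def pullOutcomes (j : Fin K) : Set (Outcome K) :=
  Sum.inl '' (Prod.fst ⁻¹' {j})

lemma measurableSet_pullOutcomes (j : Fin K) : MeasurableSet (pullOutcomes j) :=
  measurableSet_inl_image.2 (measurable_fst (measurableSet_singleton j))

/-- The event that arm `j` is pulled in round `n`, the policy not having stopped before. -/
def pulls (j : Fin K) (n : ℕ) : Set (ℕ → Outcome K) :=
  {ω | ω n ∈ pullOutcomes j ∧ ∀ m < n, (ω m).isLeft}

lemma measurableSet_pulls (j : Fin K) (n : ℕ) : MeasurableSet (pulls j n) := by
  have h : pulls j n = (fun ω : ℕ → Outcome K => ω n) ⁻¹' pullOutcomes j ∩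
      ⋂ m, ⋂ (_ : m < n), (fun ω : ℕ → Outcome K => ω m) ⁻¹' {o | o.isLeft} := by
    ext ω
    simp [pulls]
  rw [h]
  exact (measurable_pi_apply n (measurableSet_pullOutcomes j)).inter <| .iInter fun m =>
    .iInter fun _ => measurable_pi_apply m (measurableSet_isLeft K)

/-- The number of pulls of arm `j` made before the policy stops. -/
def pullCount (j : Fin K) (ω : ℕ → Outcome K) : ℝ≥0∞ :=
  ∑' n, (pulls j n).indicator 1 ω

lemma measurable_pullCount (j : Fin K) : Measurable (pullCount j) :=
  Measurable.tsum fun n => measurable_one.indicator (measurableSet_pulls j n)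

lemma sum_indicator_pulls_le_one (s : Finset (Fin K)) (n : ℕ) (ω : ℕ → Outcome K) :
    ∑ j ∈ s, (pulls j n).indicator (1 : (ℕ → Outcome K) → ℝ≥0∞) ω ≤ 1 := by
  by_cases h : ∃ i, ω ∈ pulls i n
  · obtain ⟨i, ⟨⟨i', x⟩, rfl, hx⟩, -⟩ := h
    calc ∑ j ∈ s, (pulls j n).indicator (1 : (ℕ → Outcome K) → ℝ≥0∞) ω
        ≤ ∑ j ∈ s, if j = i' then 1 else 0 := by
          refine Finset.sum_le_sum fun j _ => ?_
          refine Set.indicator_apply_le' (fun hj => ?_) fun _ => zero_le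
          obtain ⟨⟨⟨j', y⟩, rfl, hy⟩, -⟩ := hj
          rw [← hx, Sum.inl.injEq, Prod.mk.injEq] at hy
          simp [hy.1]
      _ ≤ 1 := by
          rw [Finset.sum_ite_eq']
          split_ifs <;> simp
  · push Not at h
    simp [h]

lemma sum_pullCount_le_stoppingTime (s : Finset (Fin K)) (ω : ℕ → Outcome K) :
    ∑ j ∈ s, pullCount j ω ≤ stoppingTime ω := by
  refine le_iInf₂ fun n hn => ?_
  simp only [pullCount]
  rw [← Summable.tsum_finsetSum fun _ _ => ENNReal.summable]
  rw [tsum_eq_sum (s := Finset.range n)]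
  · calc ∑ i ∈ Finset.range n, ∑ j ∈ s, (pulls j i).indicator (1 : (ℕ → Outcome K) → ℝ≥0∞) ω
        ≤ ∑ i ∈ Finset.range n, 1 := Finset.sum_le_sum fun i _ => sum_indicator_pulls_le_one s i ω
      _ = n := by simp
  · intro i hi
    refine Finset.sum_eq_zero fun j _ => Set.indicator_of_notMem (fun hj => ?_) _
    rw [Finset.mem_range, not_lt] at hi
    -- Round `n` is itself a declaration and thus not a pull; pulls in later rounds are excluded
    -- because `pulls` requires that no earlier round be a declaration.
    rcases hi.eq_or_lt with rfl | hi
    · obtain ⟨⟨p, -, hp⟩, -⟩ := hj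
      simp [← hp] at hn
    · have := hj.2 n hi
      cases h : ω n <;> simp_all

open Classical in
lemma weight_ite (j : Fin K) (c : ℝ≥0∞) (o : Outcome K) :
    weight (fun i => if i = j then c else 1) o = if o ∈ pullOutcomes j then c else 1 := by
  rcases o with ⟨i, x⟩ | k
  · by_cases h : i = j <;> simp [weight, pullOutcomes, h]
  · simp [weight, pullOutcomes]

/-- If the policy stops after at most `m` pulls of arm `j`, then the likelihood ratio is at most
`c ^ m`. -/
lemma prod_weight_le_or_le_pullCount {k j : Fin K} {n : ℕ} {ω : ℕ → Outcome K}
    (hω : ω ∈ stopsAt k n) {c : ℝ≥0∞} (hc : 1 ≤ c) (m : ℕ) :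
    ∏ i ∈ Finset.range (n + 1), weight (fun i => if i = j then c else 1) (ω i) ≤ c ^ m ∨
      (m + 1 : ℕ) ≤ pullCount j ω := by
  classical
  set t := (Finset.range (n + 1)).filter fun i => ω i ∈ pullOutcomes j with ht
  have h1 : ∏ i ∈ Finset.range (n + 1), weight (fun i => if i = j then c else 1) (ω i) =
      c ^ t.card := by
    simp_rw [weight_ite]
    rw [Finset.prod_ite, Finset.prod_const, Finset.prod_const_one, mul_one]
  have h2 : (t.card : ℝ≥0∞) ≤ pullCount j ω := by
    calc (t.card : ℝ≥0∞) = ∑ i ∈ t, (pulls j i).indicator (1 : (ℕ → Outcome K) → ℝ≥0∞) ω := by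
          rw [Finset.sum_congr rfl (g := fun _ => 1)]
          · simp
          · intro i hi
            rw [ht, Finset.mem_filter, Finset.mem_range] at hi
            have hmem : ω ∈ pulls j i := ⟨hi.2, fun m hm => hω.2 m (by omega)⟩
            simp [hmem]
      _ ≤ pullCount j ω := ENNReal.sum_le_tsum t
  rcases le_or_gt t.card m with h | h
  · left
    rw [h1]
    exact pow_le_pow_right₀ hc h
  · right
    exact le_trans (by exact_mod_cast h) h2

/-- Comparison of the probabilities of a declaration on two bandits that differ in arm `j` only. -/
lemma law_declares_le (π : Policy K) {ν ν' : Fin K → ProbabilityMeasure ℝ} {j : Fin K}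
    {c : ℝ≥0∞} (hc : 1 ≤ c) (hj : (ν j : Measure ℝ) ≤ c • (ν' j : Measure ℝ))
    (hne : ∀ i, i ≠ j → ν i = ν' i) (k : Fin K) (m : ℕ) :
    π.law ν (declares k) ≤
      π.law ν {ω | (m + 1 : ℕ) ≤ pullCount j ω} + c ^ m * π.law ν' (declares k) := by
  set C : Fin K → ℝ≥0∞ := fun i => if i = j then c else 1 with hC
  have hdom : ∀ i, (ν i : Measure ℝ) ≤ C i • (ν' i : Measure ℝ) := fun i => by
    by_cases h : i = j
    · subst h
      simpa [hC] using hj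
    · simp [hC, h, hne i h]
  -- The likelihood bound `c ^ m` is made part of the event: `B n` is then decided by the rounds up
  -- to `n`, whereas `pullCount` is defined from all rounds.
  let B : ℕ → Set (ℕ → Outcome K) := fun n =>
    stopsAt k n ∩ {ω | ∏ i ∈ Finset.range (n + 1), weight C (ω i) ≤ c ^ m}
  have hW : ∀ n, Measurable fun ω : ℕ → Outcome K =>
      ∏ i ∈ Finset.range (n + 1), weight C (ω i) := fun n =>
    Finset.measurable_prod _ fun i _ => (measurable_weight C).comp (measurable_pi_apply i)
  have hB : ∀ n, MeasurableSet (B n) := fun n =>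
    (measurableSet_stopsAt k n).inter (measurableSet_le (hW n) measurable_const)
  have hsub : declares k ⊆ {ω | (m + 1 : ℕ) ≤ pullCount j ω} ∪ ⋃ n, B n := by
    rintro ω ⟨n, hn⟩
    rcases prod_weight_le_or_le_pullCount (j := j) hn hc m with h | h
    · exact .inr (Set.mem_iUnion.2 ⟨n, hn, h⟩)
    · exact .inl h
  have hstep : ∀ n, π.law ν (B n) ≤ c ^ m * π.law ν' (stopsAt k n) := fun n => by
    calc π.law ν (B n) = ∫⁻ ω, (B n).indicator 1 ω ∂π.law ν := (lintegral_indicator_one (hB n)).symm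
      _ ≤ ∫⁻ ω, (B n).indicator 1 ω * ∏ i ∈ Finset.range (n + 1), weight C (ω i) ∂π.law ν' := by
          refine lintegral_law_le π hdom n (measurable_one.indicator (hB n)) fun ω ω' h => ?_
          have hprod : ∏ i ∈ Finset.range (n + 1), weight C (ω i) =
              ∏ i ∈ Finset.range (n + 1), weight C (ω' i) :=
            Finset.prod_congr rfl fun i hi => by
              rw [h i (Nat.lt_succ_iff.1 (Finset.mem_range.1 hi))]
          have hleft : (∀ l < n, (ω l).isLeft) ↔ ∀ l < n, (ω' l).isLeft :=
            forall₂_congr fun l hl => by rw [h l hl.le]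
          have hmem : ω ∈ B n ↔ ω' ∈ B n := by
            simp only [B, stopsAt, Set.mem_inter_iff, Set.mem_ofPred_eq, hprod, hleft, h n le_rfl]
          by_cases hb : ω ∈ B n
          · simp [hb, hmem.1 hb]
          · simp [hb, mt hmem.2 hb]
      _ ≤ ∫⁻ ω, c ^ m * (stopsAt k n).indicator 1 ω ∂π.law ν' := by
          refine lintegral_mono fun ω => ?_
          by_cases hb : ω ∈ B n
          · simpa [hb, hb.1] using hb.2
          · simp [hb]
      _ = c ^ m * π.law ν' (stopsAt k n) := by
          rw [lintegral_const_mul _ (measurable_one.indicator (measurableSet_stopsAt k n)),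
            lintegral_indicator_one (measurableSet_stopsAt k n)]
  calc π.law ν (declares k)
      ≤ π.law ν {ω | (m + 1 : ℕ) ≤ pullCount j ω} + π.law ν (⋃ n, B n) :=
        (measure_mono hsub).trans (measure_union_le _ _)
    _ ≤ π.law ν {ω | (m + 1 : ℕ) ≤ pullCount j ω} + ∑' n, c ^ m * π.law ν' (stopsAt k n) := by
        gcongr
        exact (measure_iUnion_le _).trans (ENNReal.tsum_le_tsum hstep)
    _ = _ := by rw [ENNReal.tsum_mul_left, measure_declares]

/-- A policy that declares `k` with high probability on `ν`, and another arm with high probability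
on a bandit `ν'` that differs from `ν` in arm `j` only, pulls arm `j` often on `ν`. -/
lemma le_lintegral_pullCount (π : Policy K) {ν ν' : Fin K → ProbabilityMeasure ℝ} {j k : Fin K}
    (hjk : j ≠ k) {c δ : ℝ} (hc : 1 ≤ c)
    (hj : (ν j : Measure ℝ) ≤ ENNReal.ofReal c • (ν' j : Measure ℝ))
    (hne : ∀ i, i ≠ j → ν i = ν' i) (hδ : 0 ≤ δ) (hδ1 : δ ≤ 1)
    (hk : ENNReal.ofReal (1 - δ) ≤ π.law ν (declares k))
    (hj' : ENNReal.ofReal (1 - δ) ≤ π.law ν' (declares j)) (m : ℕ) :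
    ENNReal.ofReal ((m + 1) * (1 - δ - c ^ m * δ)) ≤ ∫⁻ ω, pullCount j ω ∂π.law ν := by
  have h1 : π.law ν' (declares k) ≤ ENNReal.ofReal δ := by
    have hu : π.law ν' (declares j) + π.law ν' (declares k) ≤ 1 := by
      rw [← measure_union (disjoint_declares hjk) (measurableSet_declares k)]
      exact prob_le_one
    have hu' : ENNReal.ofReal (1 - δ) + π.law ν' (declares k) ≤
        ENNReal.ofReal (1 - δ) + ENNReal.ofReal δ := by
      rw [← ENNReal.ofReal_add (by linarith) hδ, sub_add_cancel, ENNReal.ofReal_one]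
      exact (add_le_add_left hj' _).trans hu
    exact (ENNReal.add_le_add_iff_left ENNReal.ofReal_ne_top).1 hu'
  have h2 : ENNReal.ofReal (1 - δ - c ^ m * δ) ≤ π.law ν {ω | (m + 1 : ℕ) ≤ pullCount j ω} := by
    rw [ENNReal.ofReal_sub _ (by positivity), tsub_le_iff_right]
    refine hk.trans ((law_declares_le π (by simpa using hc) hj hne k m).trans ?_)
    rw [ENNReal.ofReal_mul (by positivity), ENNReal.ofReal_pow (by linarith)]
    gcongr
  -- Markov's inequality at level `m + 1`.
  have h3 := mul_meas_ge_le_lintegral (μ := π.law ν) (measurable_pullCount j) ((m + 1 : ℕ) : ℝ≥0∞)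
  refine le_trans ?_ h3
  rw [ENNReal.ofReal_mul (by positivity), ← Nat.cast_succ, ENNReal.ofReal_natCast]
  gcongr

/-! ### The hard instance -/

/-- The weights of the hard instance: the best arm `k` has weight `1/6`, the others `7/12`. -/
def hardWeight (k : Fin K) (i : Fin K) : Set.Ioo (0 : ℝ) 1 :=
  if i = k then ⟨1 / 6, by norm_num, by norm_num⟩ else ⟨7 / 12, by norm_num, by norm_num⟩

/-- The alternative to the hard instance, in which arm `j` is the best one. -/
def altWeight (k j : Fin K) : Fin K → Set.Ioo (0 : ℝ) 1 :=
  Function.update (hardWeight k) j ⟨7 / 48, by norm_num, by norm_num⟩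

/-- The bandit whose arms are the mixtures with the given weights. -/
def mixtureBandit (w : Fin K → Set.Ioo (0 : ℝ) 1) (i : Fin K) : ProbabilityMeasure ℝ :=
  mixtureArm (w i)

lemma coe_hardWeight_self (k : Fin K) : (hardWeight k k : ℝ) = 1 / 6 := by
  simp [hardWeight]

lemma coe_hardWeight_of_ne {i k : Fin K} (h : i ≠ k) : (hardWeight k i : ℝ) = 7 / 12 := by
  simp [hardWeight, h]

lemma isBestArm_hardWeight {q : ℝ} (hq : 1 / 3 < q) (hq1 : q < 1) (k : Fin K) :
    IsBestArm q (mixtureBandit (hardWeight k)) k := by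
  refine isBestArm_mixtureArm hq1 (by rw [coe_hardWeight_self]; linarith) fun j hj => ?_
  rw [← Subtype.coe_lt_coe, coe_hardWeight_self, coe_hardWeight_of_ne hj]
  norm_num

/-- The new weight `7/48` lies just below `1/6 = 8/48`. -/
lemma altWeight_self_lt {k i j : Fin K} (h : i ≠ j) : altWeight k j j < altWeight k j i := by
  rw [← Subtype.coe_lt_coe, altWeight, Function.update_self, Function.update_of_ne h]
  by_cases hi : i = k
  · subst hi
    rw [coe_hardWeight_self]
    norm_num
  · rw [coe_hardWeight_of_ne hi]
    norm_num

lemma isBestArm_altWeight {q : ℝ} (hq : 1 / 3 < q) (hq1 : q < 1) (k j : Fin K) :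
    IsBestArm q (mixtureBandit (altWeight k j)) j := by
  refine isBestArm_mixtureArm hq1 ?_ fun i hi => altWeight_self_lt hi
  rw [altWeight, Function.update_self]
  norm_num
  linarith

lemma gap_altWeight_pos {q : ℝ} (hq : 0 < q) (hq1 : q < 1) {k i j : Fin K} (h : i ≠ j) :
    0 < gap q (mixtureBandit (altWeight k j) i) (mixtureBandit (altWeight k j) j) :=
  gap_zeroUniformMixture_pos hq hq1 (altWeight k j j).2.1.le (altWeight_self_lt h)
    (altWeight k j i).2.2

lemma gap_hardWeight {q : ℝ} {i k : Fin K} (h : i ≠ k) :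
    gap q (mixtureBandit (hardWeight k) i) (mixtureBandit (hardWeight k) k) =
      gap q (zeroUniformMixture (7 / 12)) (zeroUniformMixture (1 / 6)) := by
  rw [mixtureBandit, mixtureBandit, coe_mixtureArm, coe_mixtureArm, coe_hardWeight_self,
    coe_hardWeight_of_ne h]

/-- The value `η = (1 - q) / 3` solves `(1 - q + η) * (5/12) = (1 - q - η) * (5/6)`. -/
lemma le_gap_hard {q : ℝ} (hq : 1 / 3 < q) (hq1 : q < 1) :
    (1 - q) / 3 ≤ gap q (zeroUniformMixture (7 / 12)) (zeroUniformMixture (1 / 6)) :=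
  le_gap_zeroUniformMixture (by linarith) hq1 (by norm_num) (by norm_num) (by norm_num)
    (by norm_num) (by linarith) (by linarith) (by linarith) (by linarith)

/-- The two alternatives of `mem_gap_set_iff` bound `η` by `7/12 - q` and by `(1 - q) / 3`. The
first bound is below `1/4` exactly when `q > 1/3`. -/
lemma gap_hard_lt {q : ℝ} (hq : 1 / 3 < q) (hq1 : q < 1) :
    gap q (zeroUniformMixture (7 / 12)) (zeroUniformMixture (1 / 6)) < 1 / 4 := by
  have hb : max (7 / 12 - q) ((1 - q) / 3) < 1 / 4 := max_lt (by linarith) (by linarith)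
  refine lt_of_le_of_lt (Real.sSup_le (fun η h => ?_) ?_) hb
  · rcases ((mem_gap_set_iff (by linarith) hq1 (by norm_num) (by norm_num) (by norm_num)
      (by norm_num)).1 h).2.2.2 with h' | h'
    · exact le_max_of_le_left (by linarith)
    · exact le_max_of_le_right (by linarith)
  -- The bound must be nonnegative as well, since the real supremum of the empty set is `0`.
  · exact le_max_of_le_right (by linarith)

/-- At the atom the ratio is exactly `4`, as `7/12 = 4 * (7/48)`; on the uniform part `5/12 ≤ 4 *
(41/48)` leaves room. -/
lemma mixtureBandit_hardWeight_le {j k : Fin K} (h : j ≠ k) :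
    (mixtureBandit (hardWeight k) j : Measure ℝ) ≤
      ENNReal.ofReal 4 • (mixtureBandit (altWeight k j) j : Measure ℝ) := by
  rw [mixtureBandit, mixtureBandit, coe_mixtureArm, coe_mixtureArm, coe_hardWeight_of_ne h,
    altWeight, Function.update_self]
  exact zeroUniformMixture_le_smul (by norm_num) (by norm_num) (by norm_num)

/-- On the hard instance, a `δ`-PAC policy pulls every suboptimal arm at least
`(27 / 100) * log (1 / (4 * δ))` times on average. -/
lemma le_lintegral_pullCount_of_isPAC {q δ : ℝ} (hq : 1 / 3 < q) (hq1 : q < 1) (hδ : 0 < δ)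
    (hδ4 : δ ≤ 1 / 4) {π : Policy K} (hπ : π.IsPAC q δ) {j k : Fin K} (hjk : j ≠ k) :
    ENNReal.ofReal (27 / 100 * Real.log (1 / (4 * δ))) ≤
      ∫⁻ ω, pullCount j ω ∂π.law (mixtureBandit (hardWeight k)) := by
  have h1 : 1 ≤ 1 / (4 * δ) := by
    rw [le_div_iff₀ (by positivity)]
    linarith
  -- The largest `m` with `4^m * δ ≤ 1/4`. As `δ ≤ 1/4` too, `1 - δ - 4^m * δ ≥ 1/2`, while
  -- maximality bounds the logarithm by a multiple of `m + 1`.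
  obtain ⟨m, hm, hm'⟩ := exists_nat_pow_near h1 (by norm_num : (1 : ℝ) < 4)
  rw [le_div_iff₀ (by positivity)] at hm
  have hlog : Real.log (1 / (4 * δ)) ≤ (m + 1) * (2 * Real.log 2) := by
    have h2 := Real.log_le_log (by positivity) hm'.le
    rw [Real.log_pow, show (4 : ℝ) = 2 ^ 2 by norm_num, Real.log_pow] at h2
    norm_num at h2 ⊢
    exact h2
  refine le_trans (ENNReal.ofReal_le_ofReal ?_) (le_lintegral_pullCount π hjk
    (by norm_num : (1 : ℝ) ≤ 4) (mixtureBandit_hardWeight_le hjk) (fun i hi => ?_) hδ.le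
    (by linarith) (hπ _ k (isBestArm_hardWeight hq hq1 k) fun i hi => ?_)
    (hπ _ j (isBestArm_altWeight hq hq1 k j) fun i hi => gap_altWeight_pos (by linarith) hq1 hi) m)
  -- The constant fits because `(27/100) * 2 * log 2 < 1/2`.
  · have hl2 := Real.log_two_lt_d9
    have hm0 : (0 : ℝ) ≤ m := m.cast_nonneg
    nlinarith
  · rw [mixtureBandit, mixtureBandit, altWeight, Function.update_of_ne hi]
  · rw [gap_hardWeight hi]
    linarith [le_gap_hard hq hq1]

end QuantileBandit

end

/-! ### Summation over the suboptimal arms -/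

theorem theorem4 (K : ℕ) (hK : 1 ≤ K) (q : ℝ) (hq : 1 / 3 < q) (hq1 : q < 1)
    (δ : ℝ) (hδ : 0 < δ) (hδ1 : δ < 1) :
    ∃ (ν : Fin K → ProbabilityMeasure ℝ) (istar : Fin K),
      (∃ w : Fin K → ℝ, ∀ i, w i ∈ Set.Ioo (0 : ℝ) 1 ∧
        (ν i : Measure ℝ) = QuantileBandit.zeroUniformMixture (w i)) ∧
      QuantileBandit.IsBestArm q ν istar ∧
      (∀ i, i ≠ istar → QuantileBandit.gap q (ν i) (ν istar) ∈ Set.Ioo (0 : ℝ) (1 / 4)) ∧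
      ∀ π : QuantileBandit.Policy K, π.IsPAC q δ →
        ENNReal.ofReal (∑ j ∈ Finset.univ.erase istar,
          3 * (1 - q) ^ 2 / (100 * QuantileBandit.gap q (ν j) (ν istar) ^ 2) *
            Real.log (1 / (4 * δ)))
        ≤ ∫⁻ ω, QuantileBandit.stoppingTime ω ∂(π.law ν) := by
  obtain ⟨k⟩ : Nonempty (Fin K) := ⟨⟨0, hK⟩⟩
  have hgap := QuantileBandit.le_gap_hard hq hq1
  have hpos : 0 < QuantileBandit.gap q (QuantileBandit.zeroUniformMixture (7 / 12))
      (QuantileBandit.zeroUniformMixture (1 / 6)) := by linarith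
  refine ⟨QuantileBandit.mixtureBandit (QuantileBandit.hardWeight k), k,
    ⟨fun i => QuantileBandit.hardWeight k i, fun i => ⟨(QuantileBandit.hardWeight k i).2, rfl⟩⟩,
    QuantileBandit.isBestArm_hardWeight hq hq1 k, fun i hi => ?_, fun π hπ => ?_⟩
  · rw [QuantileBandit.gap_hardWeight hi]
    exact ⟨hpos, QuantileBandit.gap_hard_lt hq hq1⟩
  -- For `δ ≥ 1/4` the logarithm is nonpositive and the bound is trivial.
  rcases le_total (1 / 4) δ with h4 | h4
  · have hlog : Real.log (1 / (4 * δ)) ≤ 0 :=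
      Real.log_nonpos (by positivity) ((div_le_one (by positivity)).2 (by linarith))
    rw [ENNReal.ofReal_of_nonpos
      (Finset.sum_nonpos fun j _ => mul_nonpos_of_nonneg_of_nonpos (by positivity) hlog)]
    exact zero_le
  have hlog : 0 ≤ Real.log (1 / (4 * δ)) :=
    Real.log_nonneg ((one_le_div (by positivity)).2 (by linarith))
  rw [ENNReal.ofReal_sum_of_nonneg fun j _ => mul_nonneg (by positivity) hlog]
  calc _ ≤ ∑ j ∈ Finset.univ.erase k, ∫⁻ ω, QuantileBandit.pullCount j ω
          ∂π.law (QuantileBandit.mixtureBandit (QuantileBandit.hardWeight k)) := by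
        refine Finset.sum_le_sum fun j hj => ?_
        have hjk := Finset.ne_of_mem_erase hj
        refine le_trans (ENNReal.ofReal_le_ofReal (mul_le_mul_of_nonneg_right ?_ hlog))
          (QuantileBandit.le_lintegral_pullCount_of_isPAC hq hq1 hδ h4 hπ hjk)
        -- Squaring `(1 - q) / 3 ≤ Δ` gives `3 (1 - q)² / (100 Δ²) ≤ 27/100`.
        rw [QuantileBandit.gap_hardWeight hjk, div_le_div_iff₀ (by positivity) (by norm_num)]
        nlinarith [mul_self_le_mul_self (by linarith) hgap]
    _ = ∫⁻ ω, ∑ j ∈ Finset.univ.erase k, QuantileBandit.pullCount j ω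
          ∂π.law (QuantileBandit.mixtureBandit (QuantileBandit.hardWeight k)) :=
        (lintegral_finsetSum _ fun j _ => QuantileBandit.measurable_pullCount j).symm
    _ ≤ _ := lintegral_mono fun ω => QuantileBandit.sum_pullCount_le_stoppingTime _ ω
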